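/- Let $Y$ be an irreducible regular scheme, flat and projective over $\mathbb Z$, with generic point $\eta_0$ and function field $K(Y)$, and let $G$ be a finite group. Throughout, $\eta_1$ runs over the codimension one points of $Y$. For a point $x$ of $Y$ let $\hat{\mathcal O}_{Y,x}=\varprojlim_\ell \mathcal O_{Y,x}/\mathfrak m_x^\ell$ (so $\hat{\mathcal O}_{Y,\eta_0}=K(Y)$), and let $\hat{\mathcal O}_{Y,\eta_0\eta_1}=(K(Y)\setminus\{0\})^{-1}\hat{\mathcal O}_{Y,\eta_1}=K(Y)\otimes_{\mathcal O_{Y,\eta_1}}\hat{\mathcal O}_{Y,\eta_1}$ be the multicompletion of the Parshin pair $(\eta_0,\eta_1)$. For a ring $S$ put $\mathrm K_1(S)=\mathrm{GL}(S)^{\rm ab}$, where $\mathrm{GL}(S)=\bigcup_n \mathrm{GL}_n(S)$, and write $\mathrm{Det}(\lambda)\in \mathrm K_1(S)$ for the class of $\lambda\in\mathrm{GL}_n(S)$. A superscript $\flat$ denotes the image of a group in $\mathrm K_1(\hat{\mathcal O}_{Y,\eta_0\eta_1}[G])$ or in $\prod_{\eta_1}\mathrm K_1(\hat{\mathcal O}_{Y,\eta_0\eta_1}[G])$.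 Let $$\mathrm K_1'(\mathbb A_{Y,01}[G])\subset \prod_{\eta_1}\mathrm K_1(\hat{\mathcal O}_{Y,\eta_0\eta_1}[G])$$ be the subgroup of families $(\kappa_{\eta_0\eta_1})$ with $\kappa_{\eta_0\eta_1}\in \mathrm K_1(\hat{\mathcal O}_{Y,\eta_1}[G])^\flat$ for all but finitely many $\eta_1$, and let $$\mathrm{CH}^1_{\mathbb A}(Y[G])=\frac{\mathrm K_1'(\mathbb A_{Y,01}[G])}{\mathrm K_1(\hat{\mathcal O}_{Y,\eta_0}[G])^\flat\cdot\prod_{\eta_1}\mathrm K_1(\hat{\mathcal O}_{Y,\eta_1}[G])^\flat},$$ where $\mathrm K_1(\hat{\mathcal O}_{Y,\eta_0}[G])$ is mapped diagonally. Let $\mathcal E$ be an $\mathcal O_Y[G]$-bundle of rank $n$, i.e. a coherent sheaf of left $\mathcal O_Y[G]$-modules which is Zariski-locally on $Y$ free of rank $n$ over $\mathcal O_Y[G]$. Then the completed stalks $\hat{\mathcal E}_x=\mathcal E_x\otimes_{\mathcal O_{Y,x}}\hat{\mathcal O}_{Y,x}$ are free $\hat{\mathcal O}_{Y,x}[G]$-modules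 of rank $n$. For every choice of $\hat{\mathcal O}_{Y,x}[G]$-bases $e_x=(e_x^1,\dots,e_x^n)$ of $\hat{\mathcal E}_x$ for all points $x$ of $Y$ there are unique transition matrices $\lambda_{\eta_0\eta_1}\in\mathrm{GL}_n(\hat{\mathcal O}_{Y,\eta_0\eta_1}[G])$ with $e_{\eta_0}=\lambda_{\eta_0\eta_1}\cdot e_{\eta_1}$, that is, $e_{\eta_0}^h=\sum_k(\lambda_{\eta_0\eta_1})_{hk}\,e_{\eta_1}^k$ in $\mathcal E\otimes_{\mathcal O_Y}\hat{\mathcal O}_{Y,\eta_0\eta_1}$ for all $h$, and: (a) $\prod_{\eta_1}\mathrm{Det}(\lambda_{\eta_0\eta_1})$ lies in the restricted product $\mathrm K_1'(\mathbb A_{Y,01}[G])$; that is, all but finitely many of its terms lie in $\mathrm K_1(\hat{\mathcal O}_{Y,\eta_1}[G])^\flat$. (b) The class of $\prod_{\eta_1}\mathrm{Det}(\lambda_{\eta_0\eta_1})$ in $\mathrm{CH}^1_{\mathbb A}(Y[G])$ is independent of the choice of bases. Hence there is a unique element $c_1(\mathcal E)\in \mathrm{CH}^1_{\mathbb A}(Y[G])$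 which is the class of $\prod_{\eta_1}\mathrm{Det}(\lambda_{\eta_0\eta_1})$ for every choice of bases. -/

import Mathlib

open CategoryTheory AlgebraicGeometry TopologicalSpace
open scoped TensorProduct

noncomputable section

namespace AdelicChow

/-! ## The group `K₁` of a ring -/

section KOne

universe v w

variable {S : Type v} {T : Type w} [Ring S] [Ring T]

/-- The block matrix `diag(A, 1)` of size `n ≥ m` attached to an `m × m` matrix `A`. -/
def padMatrix (m n : ℕ) (A : Matrix (Fin m) (Fin m) S) : Matrix (Fin n) (Fin n) S :=
  fun i j => if h : (i : ℕ) < m ∧ (j : ℕ) < m then A ⟨i, h.1⟩ ⟨j, h.2⟩ else if i = j then 1 else 0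

theorem padMatrix_one (m n : ℕ) : padMatrix m n (1 : Matrix (Fin m) (Fin m) S) = 1 := by
  ext i j
  by_cases h : (i : ℕ) < m ∧ (j : ℕ) < m
  · simp [padMatrix, h, Matrix.one_apply, Fin.ext_iff]
  · simp [padMatrix, h, Matrix.one_apply]

theorem padMatrix_mul {m n : ℕ} (hmn : m ≤ n) (A B : Matrix (Fin m) (Fin m) S) :
    padMatrix m n (A * B) = padMatrix m n A * padMatrix m n B := by
  ext i j
  rw [Matrix.mul_apply]
  by_cases hi : (i : ℕ) < m
  · by_cases hj : (j : ℕ) < m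
    · have hl : padMatrix m n (A * B) i j = ∑ k, A ⟨i, hi⟩ k * B k ⟨j, hj⟩ := by
        simp [padMatrix, hi, hj, Matrix.mul_apply]
      rw [hl]
      refine Fintype.sum_of_injective (Fin.castLE hmn) (Fin.castLE_injective hmn) _ _ ?_ ?_
      · intro k hk
        have hkm : ¬ (k : ℕ) < m := fun h => hk ⟨⟨k, h⟩, rfl⟩
        have hik : i ≠ k := fun h => hkm (h ▸ hi)
        simp [padMatrix, hkm, hik]
      · intro k
        simp [padMatrix, hi, hj]
    · rw [Finset.sum_eq_single j]
      · have hij : i ≠ j := fun h => hj (h ▸ hi)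
        simp [padMatrix, hj, hij]
      · intro k _ hk
        simp [padMatrix, hj, hk]
      · simp
  · rw [Finset.sum_eq_single i]
    · simp [padMatrix, hi]
    · intro k _ hk
      simp [padMatrix, hi, Ne.symm hk]
    · simp

theorem padMatrix_self (m : ℕ) (A : Matrix (Fin m) (Fin m) S) : padMatrix m m A = A := by
  ext i j
  simp [padMatrix]

theorem padMatrix_pad {l m n : ℕ} (hlm : l ≤ m) (A : Matrix (Fin l) (Fin l) S) :
    padMatrix m n (padMatrix l m A) = padMatrix l n A := by
  ext i j
  by_cases h : (i : ℕ) < m ∧ (j : ℕ) < m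
  · simp [padMatrix, h, Fin.ext_iff]
  · have h' : ¬ ((i : ℕ) < l ∧ (j : ℕ) < l) :=
      fun h' => h ⟨h'.1.trans_le hlm, h'.2.trans_le hlm⟩
    simp [padMatrix, h, h']

/-- The stabilisation homomorphism `GL_m(S) → GL_n(S)`, `A ↦ diag(A, 1)`, for `m ≤ n`. -/
def stabilise (S : Type v) [Ring S] (m n : ℕ) (h : m ≤ n) : GL (Fin m) S →* GL (Fin n) S :=
  Units.map
    { toFun := padMatrix m n
      map_one' := padMatrix_one m n
      map_mul' := padMatrix_mul h }

instance stabilise_directedSystem (S : Type v) [Ring S] :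
    DirectedSystem (fun n : ℕ => GL (Fin n) S) (fun m n h => stabilise S m n h) where
  map_self _ _ := Units.ext (padMatrix_self _ _)
  map_map _ _ _ hlm _ _ := Units.ext (padMatrix_pad hlm _)

/-- The infinite general linear group `GL(S) = ⋃ₙ GL_n(S)`. -/
abbrev GLInf (S : Type v) [Ring S] : Type v :=
  DirectLimit (fun n : ℕ => GL (Fin n) S) (stabilise S)

/-- The homomorphism `GL_n(S) → GL_n(T)` induced by a ring homomorphism. -/
def glMap (f : S →+* T) (n : ℕ) : GL (Fin n) S →* GL (Fin n) T :=
  Units.map (f.mapMatrix : Matrix (Fin n) (Fin n) S →+* Matrix (Fin n) (Fin n) T).toMonoidHom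

theorem stabilise_glMap (f : S →+* T) (m n : ℕ) (h : m ≤ n) (A : GL (Fin m) S) :
    stabilise T m n h (glMap f m A) = glMap f n (stabilise S m n h A) := by
  apply Units.ext
  ext i j
  change padMatrix m n ((A : Matrix (Fin m) (Fin m) S).map f) i j = f (padMatrix m n _ i j)
  by_cases h : (i : ℕ) < m ∧ (j : ℕ) < m
  · simp [padMatrix, h]
  · rw [padMatrix, padMatrix, dif_neg h, dif_neg h]
    split_ifs <;> simp

/-- The homomorphism `GL(S) → GL(T)` induced by a ring homomorphism. -/
def glInfMap (f : S →+* T) : GLInf S →* GLInf T where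
  toFun := DirectLimit.map _ _ (fun n => glMap f n) (stabilise_glMap f)
  map_one' := by
    rw [DirectLimit.one_def 0, DirectLimit.map_def, DirectLimit.one_def 0, map_one]
  map_mul' := DirectLimit.induction₂ _ fun n A B => by
    simp_rw [DirectLimit.mul_def, DirectLimit.map_def, DirectLimit.mul_def, map_mul]

/-- `K₁(S)`, the abelianisation of `GL(S)`. -/
abbrev K1 (S : Type v) [Ring S] : Type v := Abelianization (GLInf S)

/-- The homomorphism `K₁(S) → K₁(T)` induced by a ring homomorphism. -/
def K1.map (f : S →+* T) : K1 S →* K1 T := Abelianization.map (glInfMap f)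

/-- `Det(A)`: the class in `K₁(S)` of an invertible matrix `A`. -/
def Det {n : ℕ} (A : GL (Fin n) S) : K1 S :=
  Abelianization.of (⟦⟨n, A⟩⟧ : GLInf S)

end KOne

/-! ## Completed local rings and the ring `Ô_{Y, η₀ η₁}` -/

section Completions

variable (Y : Scheme.{0})

/-- `Ô_{Y, x} = lim_ℓ O_{Y, x} / m_x ^ ℓ`. -/
def CompletedStalk (x : Y) : Type :=
  AdicCompletion (IsLocalRing.maximalIdeal (Y.presheaf.stalk x)) (Y.presheaf.stalk x)

instance (x : Y) : CommRing (CompletedStalk Y x) :=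
  inferInstanceAs (CommRing (AdicCompletion _ _))

instance (x : Y) : Algebra (Y.presheaf.stalk x) (CompletedStalk Y x) :=
  inferInstanceAs (Algebra (Y.presheaf.stalk x) (AdicCompletion _ _))

variable [IrreducibleSpace Y]

/-- The inclusion `O_{Y, y} → O_{Y, η₀} = K(Y)` of the local ring at `y` into the local ring at
the generic point `η₀`. -/
def toGeneric (y : Y) : Y.presheaf.stalk y →+* Y.presheaf.stalk (genericPoint Y) :=
  (Y.presheaf.stalkSpecializes (genericPoint_specializes y)).hom

/-- `Ô_{Y, η₀}` (that is, `K(Y)`), regarded as an algebra over `O_{Y, y}`. -/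
def CompletedGeneric (_y : Y) : Type := CompletedStalk Y (genericPoint Y)

instance (y : Y) : CommRing (CompletedGeneric Y y) :=
  inferInstanceAs (CommRing (CompletedStalk Y (genericPoint Y)))

instance (y : Y) : Algebra (Y.presheaf.stalk y) (CompletedGeneric Y y) :=
  ((algebraMap (Y.presheaf.stalk (genericPoint Y)) (CompletedStalk Y (genericPoint Y))).comp
    (toGeneric Y y)).toAlgebra

/-- The multicompletion `Ô_{Y, η₀ y} = Ô_{Y, η₀} ⊗_{O_{Y, y}} Ô_{Y, y}` of the Parshin pair
`(η₀, y)`. As `Ô_{Y, η₀} = K(Y)` is the fraction field of `O_{Y, y}`, this is the localisation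
of `Ô_{Y, y}` at the nonzero elements of `O_{Y, y}`. -/
def Multicompletion (y : Y) : Type :=
  CompletedGeneric Y y ⊗[Y.presheaf.stalk y] CompletedStalk Y y

instance (y : Y) : CommRing (Multicompletion Y y) :=
  inferInstanceAs (CommRing (CompletedGeneric Y y ⊗[Y.presheaf.stalk y] CompletedStalk Y y))

/-- The canonical map `Ô_{Y, η₀} → Ô_{Y, η₀ y}`. -/
def fromGeneric (y : Y) : CompletedStalk Y (genericPoint Y) →+* Multicompletion Y y :=
  (Algebra.TensorProduct.includeLeftRingHom :
    CompletedGeneric Y y →+* CompletedGeneric Y y ⊗[Y.presheaf.stalk y] CompletedStalk Y y)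

/-- The canonical map `Ô_{Y, y} → Ô_{Y, η₀ y}`. -/
def fromPoint (y : Y) : CompletedStalk Y y →+* Multicompletion Y y :=
  (Algebra.TensorProduct.includeRight : CompletedStalk Y y →ₐ[Y.presheaf.stalk y]
    CompletedGeneric Y y ⊗[Y.presheaf.stalk y] CompletedStalk Y y).toRingHom

instance (y : Y) : Algebra (Y.presheaf.stalk (genericPoint Y)) (Multicompletion Y y) :=
  ((fromGeneric Y y).comp (algebraMap _ _)).toAlgebra

/-- The two ways of mapping `O_{Y, y}` to `Ô_{Y, η₀ y}` agree. -/
theorem fromPoint_algebraMap (y : Y) (a : Y.presheaf.stalk y) :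
    fromPoint Y y (algebraMap _ _ a) = algebraMap _ (Multicompletion Y y) (toGeneric Y y a) :=
  (Algebra.TensorProduct.tmul_one_eq_one_tmul (A := CompletedGeneric Y y)
    (B := CompletedStalk Y y) a).symm

end Completions

/-! ## `O_Y[G]`-modules and their completed stalks

An `O_Y[G]`-module is an `O_Y`-module `E` with an action `ρ : G →* End E` of `G` by `O_Y`-linear
maps. -/

section Bundles

/-- The base change to an `A`-algebra `T` of an `A`-linear action of `G` on `V`. -/
def baseChangeRep {A : Type*} (T : Type*) {V G : Type*} [CommRing A] [CommRing T] [Algebra A T]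
    [AddCommGroup V] [Module A V] [Group G] (ρ : Representation A G V) :
    Representation T G (T ⊗[A] V) :=
  (Module.End.baseChangeHom A T V).toMonoidHom.comp ρ

variable {Y : Scheme.{0}} {G : Type*} [Group G]

/-- The action of `G` on the sections over `U` of an `O_Y[G]`-module. -/
def sectionsRep (E : Y.Modules) (ρ : G →* End E) (U : Y.Opens) :
    Representation Γ(Y, U) G Γ(E, U) where
  toFun g :=
    { toFun := ((ρ g).app U).hom
      map_add' := map_add ((ρ g).app U).hom
      map_smul' := fun r m => Scheme.Modules.Hom.app_smul (ρ g) r m }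
  map_one' := by
    ext m
    simp
  map_mul' g h := by
    ext m
    simp

/-- `(E, ρ)` is an `O_Y[G]`-bundle of rank `n`: every point has an affine open neighbourhood `U`
with sections `b₁, …, bₙ ∈ Γ(E, U)` which freely generate `E|_U` over `O_U[G]`, that is, which
restrict to a `Γ(Y, V)[G]`-basis of `Γ(E, V)` for all open `V ⊆ U`. -/
def IsBundle (E : Y.Modules) (ρ : G →* End E) (n : ℕ) : Prop :=
  ∀ y : Y, ∃ U : Y.Opens, y ∈ U ∧ IsAffineOpen U ∧ ∃ b : Fin n → Γ(E, U),
    ∀ (V : Y.Opens) (h : V ≤ U),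
      ∃ B : Module.Basis (Fin n) (MonoidAlgebra Γ(Y, V) G) (sectionsRep E ρ V).asModule,
        ∀ k, B k = E.presheaf.map (homOfLE h).op (b k)

/-- The stalk `E_x` of an `O_Y`-module. -/
def ModStalk (E : Y.Modules) (x : Y) : Type := E.presheaf.stalk x

instance (E : Y.Modules) (x : Y) : AddCommGroup (ModStalk E x) :=
  inferInstanceAs (AddCommGroup (E.presheaf.stalk x))

instance (E : Y.Modules) (x : Y) : Module (Y.presheaf.stalk x) (ModStalk E x) :=
  PresheafOfModules.instModuleCarrierStalkCommRingCatCarrierAbPresheafOpensCarrier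
    (R := Y.presheaf) E.val x

/-- The germ at `x` of a section of `E`. -/
def modGerm (E : Y.Modules) {U : Y.Opens} {x : Y} (hx : x ∈ U) : Γ(E, U) →+ ModStalk E x :=
  (E.presheaf.germ U x hx).hom

theorem modGerm_smul (E : Y.Modules) {U : Y.Opens} {x : Y} (hx : x ∈ U) (r : Γ(Y, U))
    (m : Γ(E, U)) : modGerm E hx (r • m) = Y.presheaf.germ U x hx r • modGerm E hx m :=
  PresheafOfModules.germ_smul (R := Y.presheaf) E.val x U hx r m

/-- An element of `O_{Y, x}` and an element of `E_x` are germs of sections over a common open. -/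
theorem exists_germs (E : Y.Modules) (x : Y) (r : Y.presheaf.stalk x) (m : ModStalk E x) :
    ∃ (U : Y.Opens) (hx : x ∈ U) (r' : Γ(Y, U)) (m' : Γ(E, U)),
      Y.presheaf.germ U x hx r' = r ∧ modGerm E hx m' = m := by
  obtain ⟨U, hU, s, rfl⟩ := Y.presheaf.exists_germ_eq r
  obtain ⟨V, hV, t, rfl⟩ := E.presheaf.exists_germ_eq m
  refine ⟨U ⊓ V, ⟨hU, hV⟩, Y.presheaf.map (homOfLE inf_le_left).op s,
    E.presheaf.map (homOfLE inf_le_right).op t, ?_, ?_⟩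
  · exact TopCat.Presheaf.germ_res_apply Y.presheaf (homOfLE inf_le_left) x _ s
  · exact TopCat.Presheaf.germ_res_apply E.presheaf (homOfLE inf_le_right) x _ t

/-- The map `E_x → F_x` of stalks induced by a map `E → F` of `O_Y`-modules. -/
def modStalkMap {E F : Y.Modules} (f : E ⟶ F) (x : Y) :
    ModStalk E x →ₗ[Y.presheaf.stalk x] ModStalk F x where
  toFun := ((TopCat.Presheaf.stalkFunctor Ab x).map f.mapPresheaf).hom
  map_add' := map_add ((TopCat.Presheaf.stalkFunctor Ab x).map f.mapPresheaf).hom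
  map_smul' r m := by
    obtain ⟨U, hx, r, m, rfl, rfl⟩ := exists_germs E x r m
    have key : ∀ m : Γ(E, U), ((TopCat.Presheaf.stalkFunctor Ab x).map f.mapPresheaf).hom
        (modGerm E hx m) = modGerm F hx ((f.app U).hom m) := fun m =>
      TopCat.Presheaf.stalkFunctor_map_germ_apply U x hx f.mapPresheaf m
    rw [← modGerm_smul, key, RingHom.id_apply, key, ← modGerm_smul]
    congr 1
    exact Scheme.Modules.Hom.app_smul f r m

theorem modStalkMap_germ {E F : Y.Modules} (f : E ⟶ F) {U : Y.Opens} {x : Y} (hx : x ∈ U)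
    (m : Γ(E, U)) : modStalkMap f x (modGerm E hx m) = modGerm F hx ((f.app U).hom m) :=
  TopCat.Presheaf.stalkFunctor_map_germ_apply U x hx f.mapPresheaf m

/-- The action of `G` on the stalk `E_x` of an `O_Y[G]`-module. -/
def stalkRep (E : Y.Modules) (ρ : G →* End E) (x : Y) :
    Representation (Y.presheaf.stalk x) G (ModStalk E x) where
  toFun g := modStalkMap (ρ g) x
  map_one' := by
    ext m
    obtain ⟨U, hx, -, m, -, rfl⟩ := exists_germs E x 0 m
    rw [modStalkMap_germ]
    simp
  map_mul' g h := by
    ext m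
    obtain ⟨U, hx, -, m, -, rfl⟩ := exists_germs E x 0 m
    rw [Module.End.mul_apply, modStalkMap_germ, modStalkMap_germ, modStalkMap_germ]
    simp

/-- The completed stalk `Ê_x = Ô_{Y, x} ⊗_{O_{Y, x}} E_x`, with its structure of left module over
`Ô_{Y, x}[G]`. -/
abbrev CompletedModStalk (E : Y.Modules) (ρ : G →* End E) (x : Y) : Type :=
  (baseChangeRep (CompletedStalk Y x) (stalkRep E ρ x)).asModule

variable [IrreducibleSpace Y]

/-- The specialisation map `E_y → E_{η₀}` from the stalk at `y` to the stalk at the generic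
point. -/
def modToGeneric (E : Y.Modules) (y : Y) : ModStalk E y →+ ModStalk E (genericPoint Y) :=
  (E.presheaf.stalkSpecializes (genericPoint_specializes y)).hom

theorem modToGeneric_smul (E : Y.Modules) (y : Y) (r : Y.presheaf.stalk y) (m : ModStalk E y) :
    modToGeneric E y (r • m) = toGeneric Y y r • modToGeneric E y m := by
  obtain ⟨U, hx, r, m, rfl, rfl⟩ := exists_germs E y r m
  have h := genericPoint_specializes y
  have hm : ∀ m : Γ(E, U), modToGeneric E y (modGerm E hx m) =
      modGerm E (h.mem_open U.isOpen hx) m :=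
    fun m => TopCat.Presheaf.germ_stalkSpecializes_apply E.presheaf hx h m
  have hr : toGeneric Y y (Y.presheaf.germ U y hx r) =
      Y.presheaf.germ U (genericPoint Y) (h.mem_open U.isOpen hx) r :=
    TopCat.Presheaf.germ_stalkSpecializes_apply Y.presheaf hx h r
  rw [← modGerm_smul, hm, hr, hm, modGerm_smul]

/-- `Ê_{η₀ y} = Ô_{Y, η₀ y} ⊗ E`, with its structure of left module over `Ô_{Y, η₀ y}[G]`; the
tensor product is formed over `O_{Y, η₀} = K(Y)`, with the generic stalk `E_{η₀}`. -/
abbrev GenericModStalk (E : Y.Modules) (ρ : G →* End E) (y : Y) : Type :=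
  (baseChangeRep (Multicompletion Y y) (stalkRep E ρ (genericPoint Y))).asModule

/-- The canonical map `Ê_{η₀} → Ê_{η₀ y}`. -/
def modFromGeneric (E : Y.Modules) (ρ : G →* End E) (y : Y) :
    CompletedModStalk E ρ (genericPoint Y) →+ GenericModStalk E ρ y :=
  (LinearMap.rTensor (ModStalk E (genericPoint Y))
    ({ fromGeneric Y y with commutes' := fun _ => rfl } :
      CompletedStalk Y (genericPoint Y) →ₐ[Y.presheaf.stalk (genericPoint Y)]
        Multicompletion Y y).toLinearMap).toAddMonoidHom

/-- The canonical map `Ê_y → Ê_{η₀ y}`. -/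
def modFromPoint (E : Y.Modules) (ρ : G →* End E) (y : Y) :
    CompletedModStalk E ρ y →+ GenericModStalk E ρ y :=
  TensorProduct.liftAddHom (R := Y.presheaf.stalk y)
    (M := CompletedStalk Y y) (N := ModStalk E y)
    (P := Multicompletion Y y ⊗[Y.presheaf.stalk (genericPoint Y)] ModStalk E (genericPoint Y))
    (AddMonoidHom.mk' (fun b => AddMonoidHom.mk' (fun m => fromPoint Y y b ⊗ₜ modToGeneric E y m)
      (fun m m' => by rw [map_add, TensorProduct.tmul_add]))
      (fun b b' => by ext m; simp [TensorProduct.add_tmul]))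
    (fun r b m => by
      simp only [AddMonoidHom.mk'_apply]
      rw [modToGeneric_smul, Algebra.smul_def, map_mul, fromPoint_algebraMap, ← Algebra.smul_def,
        TensorProduct.smul_tmul])

/-- A choice, for every point `x` of `Y`, of an `Ô_{Y, x}[G]`-basis `e_x = (e_x^1, …, e_x^n)` of
the completed stalk `Ê_x`. -/
abbrev LocalBases (E : Y.Modules) (ρ : G →* End E) (n : ℕ) : Type _ :=
  ∀ x : Y, Module.Basis (Fin n) (MonoidAlgebra (CompletedStalk Y x) G) (CompletedModStalk E ρ x)

/-- The points of codimension one of `Y`. -/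
abbrev CodimOne (Y : Scheme.{0}) : Type := {y : Y // Order.coheight y = 1}

/-- The matrices `λ_{η₀ η₁} ∈ GL_n(Ô_{Y, η₀ η₁}[G])`, `η₁` of codimension one, are the transition
matrices of the system of bases `e`: in `Ê_{η₀ η₁}` we have `e_{η₀}^h = ∑ₖ (λ_{η₀ η₁})_{hk} e_{η₁}^k`
for all `h`. -/
def IsTransition {E : Y.Modules} {ρ : G →* End E} {n : ℕ} (e : LocalBases E ρ n)
    (lam : ∀ y : CodimOne Y, GL (Fin n) (MonoidAlgebra (Multicompletion Y y.1) G)) : Prop :=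
  ∀ (y : CodimOne Y) (h : Fin n),
    modFromGeneric E ρ y.1 (e (genericPoint Y) h) =
      ∑ k, (lam y).val h k • modFromPoint E ρ y.1 (e y.1 k)

end Bundles

/-! ## The first equivariant adelic Chow group -/

section Chow

variable (Y : Scheme.{0}) [IrreducibleSpace Y] (G : Type*) [Group G]

/-- The unrestricted product `K₁(𝔸_{Y, 01}[G]) = ∏_{η₁} K₁(Ô_{Y, η₀ η₁}[G])` over the points `η₁` of
codimension one. -/
abbrev K1Adele01 : Type _ := ∀ y : CodimOne Y, K1 (MonoidAlgebra (Multicompletion Y y.1) G)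

/-- `K₁(Ô_{Y, y}[G])^♭`: the image of `K₁(Ô_{Y, y}[G])` in `K₁(Ô_{Y, η₀ y}[G])`. -/
def K1PointFlat (y : Y) : Subgroup (K1 (MonoidAlgebra (Multicompletion Y y) G)) :=
  (K1.map (MonoidAlgebra.mapRingHom G (fromPoint Y y))).range

/-- The restricted product `K₁'(𝔸_{Y, 01}[G])`: the families `(κ_{η₀ η₁})` with
`κ_{η₀ η₁} ∈ K₁(Ô_{Y, η₁}[G])^♭` for all but finitely many `η₁`. -/
def K1Adele01' : Subgroup (K1Adele01 Y G) where
  carrier := {κ | {y : CodimOne Y | κ y ∉ K1PointFlat Y G y.1}.Finite}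
  one_mem' := by simp [one_mem]
  mul_mem' {a b} ha hb := by
    refine (Set.Finite.union ha hb).subset fun y hy => ?_
    by_contra h
    simp only [Set.mem_union, Set.mem_ofPred_eq, not_or, not_not] at h
    exact hy (mul_mem h.1 h.2)
  inv_mem' {a} ha := by simpa using ha

/-- `K₁(𝔸_{Y, 0}[G])^♭`: the image of `K₁(Ô_{Y, η₀}[G])` in the product under the diagonal map. -/
def K1Adele0Flat : Subgroup (K1Adele01 Y G) :=
  (MonoidHom.pi fun y : CodimOne Y =>
    K1.map (MonoidAlgebra.mapRingHom G (fromGeneric Y y.1))).range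

/-- `K₁(𝔸_{Y, 1}[G])^♭ = ∏_{η₁} K₁(Ô_{Y, η₁}[G])^♭`. -/
def K1Adele1Flat : Subgroup (K1Adele01 Y G) :=
  Subgroup.pi Set.univ fun y : CodimOne Y => K1PointFlat Y G y.1

/-- The first equivariant adelic Chow group
`CH¹_𝔸(Y[G]) = K₁'(𝔸_{Y, 01}[G]) / (K₁(𝔸_{Y, 0}[G])^♭ · K₁(𝔸_{Y, 1}[G])^♭)`. -/
abbrev CH1 : Type _ :=
  K1Adele01' Y G ⧸ (K1Adele0Flat Y G ⊔ K1Adele1Flat Y G).subgroupOf (K1Adele01' Y G)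

/-- `∏_{η₁} Det(λ_{η₀ η₁})`, the family of the classes in `K₁(Ô_{Y, η₀ η₁}[G])`. -/
def prodDet {Y : Scheme.{0}} [IrreducibleSpace Y] {G : Type*} [Group G] {n : ℕ}
    (lam : ∀ y : CodimOne Y, GL (Fin n) (MonoidAlgebra (Multicompletion Y y.1) G)) :
    K1Adele01 Y G :=
  fun y => Det (lam y)

end Chow

/-- `Y` is projective over `ℤ`: it is a closed subscheme of some projective space `ℙ^N_ℤ`. (Every
morphism of schemes is a morphism over `Spec ℤ`.) -/
def IsProjectiveOverInt (Y : Scheme.{0}) : Prop :=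
  letI := fun N : ℕ => MvPolynomial.gradedAlgebra (σ := Fin (N + 1)) (R := ℤ)
  ∃ (N : ℕ) (i : Y ⟶ Proj (MvPolynomial.homogeneousSubmodule (Fin (N + 1)) ℤ)), IsClosedImmersion i

/-- `Y` is regular: all its local rings are regular. -/
def IsRegularScheme (Y : Scheme.{0}) : Prop :=
  ∀ y : Y, IsRegularLocalRing (Y.presheaf.stalk y)

end AdelicChow

end

open AdelicChow

/-!
The theorem compares arbitrary systems of bases with those coming from local frames. A frame `b` of
`E` over an open set `U` gives the basis `1 ⊗ b` of every completed stalk over `U` and of every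
`Ê_{η₀ y}` with `y ∈ U`, compatibly with the canonical maps (`IsFrame.exists_bases`). Over the
noncommutative ring `A[G]` this rests on `asModule_basis_iff`: a family is an `A[G]`-basis if and
only if its `G`-translates are an `A`-basis, a condition that passes to stalks and to base changes.

The canonical maps `Ê_{η₀} → Ê_{η₀ y} ← Ê_y` are semilinear for the maps of group rings, so they
carry a change of basis by `P` to a change of basis by the image of `P`. Hence the images of any two
bases differ from the image of a frame by invertible matrices, which gives existence and uniqueness
of `λ_{η₀ y}`; and if `e'_x = A_x e_x`, then `λ'_{η₀ y} = A_{η₀} λ_{η₀ y} A_y⁻¹`. Taking classes in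
the commutative group `K₁` shows that the class of `∏ Det(λ_{η₀ y})` does not change
(`IsBundle.inv_prodDet_mul_prodDet_mem`).

For the restricted product, fix a frame on a neighbourhood `U` of `η₀` and let `P` be the matrix
expressing `e_{η₀}` in it. For `y ∈ U` the matrix `λ_{η₀ y}` is `P` times a matrix over `Ô_{Y, y}[G]`.
As `Y` is regular, `Ô_{Y, η₀}` is the stalk at `η₀`, so `P` and its inverse are defined over a
nonempty open set `W` (`exists_glMap_fromPoint_eq`), and `Det(λ_{η₀ y})` comes from `K₁(Ô_{Y, y}[G])`
for all `y ∈ U ∩ W`. Since `Y` is Noetherian, only finitely many points of codimension one lie outside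
`U ∩ W` (`finite_codimOne_notMem`).
-/

noncomputable section

namespace AdelicChow

/-! ### Noetherianity and the generic point -/

/-- A codimension one point outside `W` is the generic point of an irreducible component of the
complement of `W`, and there are finitely many of these. -/
theorem finite_codimOne_notMem {Y : Scheme.{0}} [IrreducibleSpace Y] [NoetherianSpace Y]
    (W : Y.Opens) (hW : genericPoint Y ∈ W) : {y : CodimOne Y | y.1 ∉ W}.Finite := by
  obtain ⟨S, hS, hSc, hSi, hSU⟩ :=
    NoetherianSpace.exists_finite_set_isClosed_irreducible W.isOpen.isClosed_compl
  refine Set.Finite.of_finite_image (f := fun y : CodimOne Y => closure {y.1}) (hS.subset ?_) ?_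
  · rintro _ ⟨y, hy, rfl⟩
    have hyS : y.1 ∈ ⋃₀ S := hSU ▸ hy
    obtain ⟨C, hCS, hyC⟩ := hyS
    obtain ⟨z, hz⟩ := QuasiSober.sober (hSi C hCS) (hSc C hCS)
    have hzy : z ⤳ y.1 := hz.specializes hyC
    have hzW : z ∉ W := by
      have : z ∈ (W : Set Y)ᶜ := hSU ▸ ⟨C, hCS, hz.mem⟩
      exact this
    suffices h : z = y.1 by
      change closure {y.1} ∈ S
      rw [← h, hz.def]
      exact hCS
    -- If `z ≠ y`, then `y < z < η₀` is a chain contradicting `coheight y = 1`.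
    by_contra hne
    have h1 : y.1 < z := lt_of_le_not_ge hzy fun h => hne (hzy.antisymm h).eq
    have h2 : z < genericPoint Y := lt_of_le_not_ge (genericPoint_specializes z)
      fun h : z ⤳ genericPoint Y => hzW (h.mem_open W.isOpen hW)
    have h3 := Order.coheight_add_one_le h1
    have h4 := Order.coheight_add_one_le h2
    rw [y.2] at h3
    have h5 : Order.coheight z ≤ 0 :=
      (ENat.add_le_add_iff_right ENat.one_ne_top).1 ((zero_add (1 : ℕ∞)).symm ▸ h3)
    exact absurd (h4.trans h5) (by simp)
  · intro y _ y' _ h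
    have h' : Inseparable y.1 y'.1 := inseparable_iff_closure_eq.2 h
    exact Subtype.ext h'.eq

theorem isNoetherian_of_isProjectiveOverInt {Y : Scheme.{0}} (h : IsProjectiveOverInt Y) :
    IsNoetherian Y := by
  let inst := fun N : ℕ => MvPolynomial.gradedAlgebra (σ := Fin (N + 1)) (R := ℤ)
  obtain ⟨N, i, hi⟩ := h
  let 𝒜 := MvPolynomial.homogeneousSubmodule (Fin (N + 1)) ℤ
  have : IsScalarTower ℤ (𝒜 0) (MvPolynomial (Fin (N + 1)) ℤ) :=
    ⟨fun k a x => smul_assoc k (a : MvPolynomial (Fin (N + 1)) ℤ) x⟩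
  have hft : Algebra.FiniteType (𝒜 0) (MvPolynomial (Fin (N + 1)) ℤ) :=
    Algebra.FiniteType.of_restrictScalars_finiteType ℤ _ _
  have hN : IsNoetherianRing (𝒜 0) :=
    isNoetherianRing_of_surjective _ _ (GradedRing.projZeroRingHom' 𝒜)
      (GradedRing.projZeroRingHom'_surjective 𝒜)
  let p := i ≫ Proj.toSpecZero 𝒜
  have : IsLocallyNoetherian Y := LocallyOfFiniteType.isLocallyNoetherian p
  have : CompactSpace Y := QuasiCompact.compactSpace_of_compactSpace p
  constructor

/-- The generic stalk has dimension zero, so regularity leaves no generators for its maximal ideal. -/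
theorem maximalIdeal_genericPoint_eq_bot {Y : Scheme.{0}} [IrreducibleSpace Y]
    (h : IsRegularScheme Y) :
    IsLocalRing.maximalIdeal (Y.presheaf.stalk (genericPoint Y)) = ⊥ := by
  have := h (genericPoint Y)
  have h0 : Order.coheight (genericPoint Y) = 0 :=
    Order.coheight_eq_zero.2 fun z _ => genericPoint_specializes z
  have h1 := (isRegularLocalRing_iff (Y.presheaf.stalk (genericPoint Y))).1 this
  rw [ringKrullDim_stalk_eq_coheight, h0] at h1
  have h2 : (IsLocalRing.maximalIdeal (Y.presheaf.stalk (genericPoint Y))).spanFinrank = 0 := by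
    exact_mod_cast h1
  exact (Submodule.spanFinrank_eq_zero_iff_eq_bot (IsNoetherian.noetherian _)).1 h2

/-- `Ô_{Y, η₀} = K(Y)`: the completion at the zero ideal changes nothing. -/
theorem bijective_algebraMap_completedStalk_genericPoint {Y : Scheme.{0}} [IrreducibleSpace Y]
    (h : IsRegularScheme Y) :
    Function.Bijective (algebraMap (Y.presheaf.stalk (genericPoint Y))
      (CompletedStalk Y (genericPoint Y))) := by
  have : IsAdicComplete (IsLocalRing.maximalIdeal (Y.presheaf.stalk (genericPoint Y)))
      (Y.presheaf.stalk (genericPoint Y)) := by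
    rw [maximalIdeal_genericPoint_eq_bot h]
    infer_instance
  exact AdicCompletion.of_bijective (IsLocalRing.maximalIdeal (Y.presheaf.stalk (genericPoint Y)))
      (Y.presheaf.stalk (genericPoint Y))

/-! ### Functoriality of `Det` -/

section Det

universe v w
variable {S : Type v} {T : Type w} [Ring S] [Ring T] {n : ℕ}

theorem Det_mul (A B : GL (Fin n) S) : Det (A * B) = Det A * Det B := by
  rw [Det, Det, Det, ← map_mul, DirectLimit.mul_def]

theorem K1_map_Det (f : S →+* T) (A : GL (Fin n) S) : K1.map f (Det A) = Det (glMap f n A) :=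
  rfl

end Det

/-! ### Matrices over noncommutative rings acting on families of vectors -/

section MatrixAction

open scoped Matrix.Module

variable {R S M N : Type*} [Ring R] [Ring S] [AddCommGroup M] [Module R M] [AddCommGroup N]
  [Module S N] {n : ℕ}

theorem smul_basis_injective (b : Module.Basis (Fin n) R M) :
    Function.Injective fun A : Matrix (Fin n) (Fin n) R => A • (b : Fin n → M) := by
  intro A B h
  ext i j
  have := congr(b.repr $(congr_fun h i) j)
  simpa [Matrix.Module.smul_apply, Finsupp.single_apply] using this

theorem exists_eq_smul_basis (b : Module.Basis (Fin n) R M) (v : Fin n → M) :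
    ∃ A : Matrix (Fin n) (Fin n) R, v = A • (b : Fin n → M) :=
  ⟨fun i j => b.repr (v i) j, funext fun i => (b.sum_repr (v i)).symm⟩

theorem exists_basis_eq_GL_smul (b c : Module.Basis (Fin n) R M) :
    ∃ A : GL (Fin n) R, (c : Fin n → M) = A.val • (b : Fin n → M) := by
  obtain ⟨A, hA⟩ := exists_eq_smul_basis b c
  obtain ⟨B, hB⟩ := exists_eq_smul_basis c b
  refine ⟨⟨A, B, smul_basis_injective c ?_, smul_basis_injective b ?_⟩, hA⟩
  · simp only [mul_smul, ← hB, ← hA, one_smul]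
  · simp only [mul_smul, ← hB, ← hA, one_smul]

theorem comp_smul_of_semilinear {σ : R →+* S} (f : M →+ N)
    (hf : ∀ r m, f (r • m) = σ r • f m) (A : Matrix (Fin n) (Fin n) R) (v : Fin n → M) :
    f ∘ (A • v) = σ.mapMatrix A • (f ∘ v) := by
  ext i
  simp [Matrix.Module.smul_apply, hf]

theorem comp_GL_smul_of_semilinear {σ : R →+* S} (f : M →+ N)
    (hf : ∀ r m, f (r • m) = σ r • f m) (A : GL (Fin n) R) (v : Fin n → M) :
    f ∘ (A.val • v) = (glMap σ n A).val • (f ∘ v) :=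
  comp_smul_of_semilinear f hf A.val v

end MatrixAction

/-! ### Bases over a group ring -/

section GroupRing

variable {A V G ι : Type*} [CommRing A] [AddCommGroup V] [Module A V] [Group G]
  (ρ : Representation A G V)

/-- The family `b` is a basis over `A[G]` if and only if its `G`-translates form a basis over `A`. This
reduces localisation and base change of `A[G]`-bases to the commutative case. -/
theorem asModule_basis_iff (b : ι → V) :
    (∃ B : Module.Basis ι (MonoidAlgebra A G) ρ.asModule,
        ∀ i, B i = ρ.asModuleEquiv.symm (b i)) ↔
      ∃ B : Module.Basis (G × ι) A V, ∀ g i, B (g, i) = ρ g (b i) := by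
  constructor
  · rintro ⟨B, hB⟩
    refine ⟨((MonoidAlgebra.basis G A).smulTower B).map ρ.asModuleEquiv, fun g i => ?_⟩
    rw [Module.Basis.map_apply, Module.Basis.smulTower_apply, MonoidAlgebra.basis_apply, hB,
      Representation.single_smul, one_smul, LinearEquiv.apply_symm_apply]
    rfl
  · rintro ⟨C, hC⟩
    let Φ : (ι →₀ MonoidAlgebra A G) →ₗ[MonoidAlgebra A G] ρ.asModule :=
      Finsupp.linearCombination _ fun i => ρ.asModuleEquiv.symm (b i)
    -- `Φ` carries the `A`-basis `D` of the free module, indexed by `G × ι`, to the basis `C`.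
    let D : Module.Basis (G × ι) A (ι →₀ MonoidAlgebra A G) :=
      (MonoidAlgebra.basis G A).smulTower
        (Finsupp.basisSingleOne : Module.Basis ι (MonoidAlgebra A G) (ι →₀ MonoidAlgebra A G))
    have hΦ : Φ.restrictScalars A =
        ((D.equiv C (Equiv.refl _)).trans ρ.asModuleEquiv.symm).toLinearMap := by
      refine D.ext fun ⟨g, i⟩ => ?_
      have h1 : Φ (D (g, i)) = ρ.asModuleEquiv.symm (ρ g (b i)) := by
        rw [Module.Basis.smulTower_apply, MonoidAlgebra.basis_apply,
          Finsupp.coe_basisSingleOne, map_smul, Finsupp.linearCombination_single, one_smul,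
          Representation.single_smul, one_smul]
        rfl
      simpa [hC] using h1
    have hbij : Function.Bijective Φ := by
      have : (Φ : (ι →₀ MonoidAlgebra A G) → ρ.asModule) =
          (D.equiv C (Equiv.refl _)).trans ρ.asModuleEquiv.symm :=
        funext fun x => LinearMap.congr_fun hΦ x
      rw [this]
      exact LinearEquiv.bijective _
    refine ⟨.ofRepr (LinearEquiv.ofBijective Φ hbij).symm, fun i => ?_⟩
    rw [Module.Basis.coe_ofRepr]
    change Φ (Finsupp.single i 1) = _
    rw [Finsupp.linearCombination_single, one_smul]

theorem baseChange_asModule_basis (T : Type*) [CommRing T] [Algebra A T]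
    (B : Module.Basis ι (MonoidAlgebra A G) ρ.asModule) :
    ∃ B' : Module.Basis ι (MonoidAlgebra T G) (baseChangeRep T ρ).asModule,
      ∀ i, B' i = (1 : T) ⊗ₜ[A] ρ.asModuleEquiv (B i) := by
  obtain ⟨C, hC⟩ := (asModule_basis_iff ρ (fun i => ρ.asModuleEquiv (B i))).1 ⟨B, fun i => rfl⟩
  refine (asModule_basis_iff (baseChangeRep T ρ) _).2 ⟨C.baseChange T, fun g i => ?_⟩
  rw [Module.Basis.baseChange_apply, hC]
  rfl

/-- An additive map which is semilinear for the scalars and commutes with `G` is semilinear for the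
group rings. -/
theorem semilinear_of_single {A' V' : Type*} [CommRing A'] [AddCommGroup V'] [Module A' V']
    (ρ' : Representation A' G V') (σ : A →+* A') (f : ρ.asModule →+ ρ'.asModule)
    (hf : ∀ (a : A) (g : G) (v : V), f (a • ρ g v : V) = (σ a • ρ' g (f v) : V'))
    (r : MonoidAlgebra A G) (m : ρ.asModule) :
    f (r • m) = MonoidAlgebra.mapRingHom G σ r • f m := by
  induction r using MonoidAlgebra.induction_linear with
  | zero => simp
  | add x y hx hy => simp [add_smul, hx, hy]
  | single g a =>
    rw [MonoidAlgebra.coe_mapRingHom, MonoidAlgebra.map_single, Representation.single_smul,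
      Representation.single_smul]
    exact hf a g m

/-- The criterion `semilinear_of_single` for a base change, checked on pure tensors. -/
theorem semilinear_of_tmul {T A' V' : Type*} [CommRing T] [Algebra A T] [CommRing A']
    [AddCommGroup V'] [Module A' V'] (ρ' : Representation A' G V') (σ : T →+* A')
    (f : (baseChangeRep T ρ).asModule →+ ρ'.asModule)
    (hf : ∀ (a s : T) (g : G) (v : V),
      f ((a * s) ⊗ₜ[A] ρ g v : T ⊗[A] V) = (σ a • ρ' g (f (s ⊗ₜ[A] v : T ⊗[A] V)) : V'))
    (r : MonoidAlgebra T G) (m : (baseChangeRep T ρ).asModule) :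
    f (r • m) = MonoidAlgebra.mapRingHom G σ r • f m := by
  refine semilinear_of_single _ ρ' σ f (fun a g m => ?_) r m
  let φ : T ⊗[A] V →+ V' :=
    (f : T ⊗[A] V →+ V').comp ((a • baseChangeRep T ρ g : Module.End T (T ⊗[A] V)) : _ →+ T ⊗[A] V)
  let ψ : T ⊗[A] V →+ V' :=
    ((σ a • ρ' g : Module.End A' V') : V' →+ V').comp (f : T ⊗[A] V →+ V')
  change φ m = ψ m
  induction m using TensorProduct.induction_on with
  | zero => rw [map_zero, map_zero]
  | add m m' h h' => rw [map_add, map_add, h, h']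
  | tmul s v => exact hf a s g v

end GroupRing

/-! ### Spreading out germs -/

section Germs

variable {Y : Scheme.{0}} {x : Y} {ι : Type*} [Finite ι]

theorem exists_germ_family_eq {U : Y.Opens} (hx : x ∈ U) (c : ι → Y.presheaf.stalk x) :
    ∃ (V : Y.Opens) (_ : V ≤ U) (hV : x ∈ V) (c' : ι → Γ(Y, V)),
      ∀ i, Y.presheaf.germ V x hV (c' i) = c i := by
  have := Fintype.ofFinite ι
  choose W hW s hs using fun i => Y.presheaf.exists_germ_eq (c i)
  have hV : x ∈ U ⊓ Finset.univ.inf W :=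
    ⟨hx, by simpa [Opens.coe_finset_inf] using hW⟩
  have hle : ∀ i, U ⊓ Finset.univ.inf W ≤ W i :=
    fun i => inf_le_right.trans (Finset.inf_le (Finset.mem_univ i))
  refine ⟨_, inf_le_left, hV, fun i => Y.presheaf.map (homOfLE (hle i)).op (s i), fun i => ?_⟩
  rw [← hs i]
  exact TopCat.Presheaf.germ_res_apply Y.presheaf (homOfLE (hle i)) x hV (s i)

theorem exists_res_family_eq {U : Y.Opens} (hx : x ∈ U) (a b : ι → Γ(Y, U))
    (h : ∀ i, Y.presheaf.germ U x hx (a i) = Y.presheaf.germ U x hx (b i)) :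
    ∃ (V : Y.Opens) (hVU : V ≤ U) (_ : x ∈ V), ∀ i,
      Y.presheaf.map (homOfLE hVU).op (a i) = Y.presheaf.map (homOfLE hVU).op (b i) := by
  have := Fintype.ofFinite ι
  choose W hW iU iV hs using fun i => Y.presheaf.germ_eq x hx hx (a i) (b i) (h i)
  have hV : x ∈ U ⊓ Finset.univ.inf W :=
    ⟨hx, by simpa [Opens.coe_finset_inf] using hW⟩
  have hle : ∀ i, U ⊓ Finset.univ.inf W ≤ W i :=
    fun i => inf_le_right.trans (Finset.inf_le (Finset.mem_univ i))
  refine ⟨_, inf_le_left, hV, fun i => ?_⟩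
  have key : ∀ s : Γ(Y, U), Y.presheaf.map (homOfLE (inf_le_left (b := Finset.univ.inf W))).op s =
      Y.presheaf.map (homOfLE (hle i)).op (Y.presheaf.map (iU i).op s) := fun s => by
    rw [← CommRingCat.comp_apply, ← Functor.map_comp]
    rfl
  rw [key, key, hs i, Subsingleton.elim (iV i) (iU i)]

variable {G : Type*} [Group G] [Finite G]

theorem exists_monoidAlgebra_germ_eq {U : Y.Opens} (hx : x ∈ U)
    (a : ι → MonoidAlgebra (Y.presheaf.stalk x) G) :
    ∃ (V : Y.Opens) (_ : V ≤ U) (hV : x ∈ V) (a' : ι → MonoidAlgebra Γ(Y, V) G),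
      ∀ i, MonoidAlgebra.mapRingHom G (Y.presheaf.germ V x hV).hom (a' i) = a i := by
  obtain ⟨V, hVU, hV, c, hc⟩ := exists_germ_family_eq hx fun p : ι × G => (a p.1).coeff p.2
  refine ⟨V, hVU, hV, fun i => .ofCoeff (Finsupp.equivFunOnFinite.symm fun g => c (i, g)),
    fun i => ?_⟩
  ext g
  simpa using hc (i, g)

theorem exists_monoidAlgebra_res_eq {U : Y.Opens} (hx : x ∈ U) (a b : ι → MonoidAlgebra Γ(Y, U) G)
    (h : ∀ i, MonoidAlgebra.mapRingHom G (Y.presheaf.germ U x hx).hom (a i) =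
      MonoidAlgebra.mapRingHom G (Y.presheaf.germ U x hx).hom (b i)) :
    ∃ (V : Y.Opens) (hVU : V ≤ U) (_ : x ∈ V), ∀ i,
      MonoidAlgebra.mapRingHom G (Y.presheaf.map (homOfLE hVU).op).hom (a i) =
        MonoidAlgebra.mapRingHom G (Y.presheaf.map (homOfLE hVU).op).hom (b i) := by
  obtain ⟨V, hVU, hV, hc⟩ := exists_res_family_eq hx (fun p : ι × G => (a p.1).coeff p.2)
    (fun p : ι × G => (b p.1).coeff p.2) fun p => by
      simpa using congr(($(h p.1)).coeff p.2)
  refine ⟨V, hVU, hV, fun i => ?_⟩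
  ext g
  simpa using hc (i, g)

end Germs

theorem exists_GL_germ_eq {Y : Scheme.{0}} {x : Y} {G : Type*} [Group G] [Finite G] {n : ℕ}
    (P : GL (Fin n) (MonoidAlgebra (Y.presheaf.stalk x) G)) :
    ∃ (V : Y.Opens) (hV : x ∈ V) (Q : GL (Fin n) (MonoidAlgebra Γ(Y, V) G)),
      glMap (MonoidAlgebra.mapRingHom G (Y.presheaf.germ V x hV).hom) n Q = P := by
  obtain ⟨U, -, hU, a, ha⟩ := exists_monoidAlgebra_germ_eq (U := ⊤) (x := x) trivial
    (Sum.elim (fun p : Fin n × Fin n => P.val p.1 p.2) (fun p : Fin n × Fin n => P.inv p.1 p.2))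
  -- `A` and `B` lift `P` and its inverse; they are inverse to each other only after shrinking `U`.
  let A : Matrix (Fin n) (Fin n) (MonoidAlgebra Γ(Y, U) G) := fun i j => a (.inl (i, j))
  let B : Matrix (Fin n) (Fin n) (MonoidAlgebra Γ(Y, U) G) := fun i j => a (.inr (i, j))
  let σ := MonoidAlgebra.mapRingHom G (Y.presheaf.germ U x hU).hom
  have hA : σ.mapMatrix A = P.val := by
    ext1 i j
    exact ha (.inl (i, j))
  have hB : σ.mapMatrix B = P.inv := by
    ext1 i j
    exact ha (.inr (i, j))
  have hAB : σ.mapMatrix (A * B) = σ.mapMatrix 1 := by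
    rw [map_mul, hA, hB, P.val_inv, map_one]
  have hBA : σ.mapMatrix (B * A) = σ.mapMatrix 1 := by
    rw [map_mul, hA, hB, P.inv_val, map_one]
  obtain ⟨V, hVU, hV, h⟩ := exists_monoidAlgebra_res_eq hU
    (Sum.elim (fun p : Fin n × Fin n => (A * B) p.1 p.2) (fun p : Fin n × Fin n => (B * A) p.1 p.2))
    (Sum.elim (fun p : Fin n × Fin n => (1 : Matrix (Fin n) (Fin n) _) p.1 p.2)
      (fun p : Fin n × Fin n => (1 : Matrix (Fin n) (Fin n) _) p.1 p.2))
    (by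
      rintro (p | p)
      · exact congr_fun₂ hAB p.1 p.2
      · exact congr_fun₂ hBA p.1 p.2)
  let τ := MonoidAlgebra.mapRingHom G (Y.presheaf.map (homOfLE hVU).op).hom
  refine ⟨V, hV, ⟨τ.mapMatrix A, τ.mapMatrix B, ?_, ?_⟩, ?_⟩
  · rw [← map_mul, ← map_one τ.mapMatrix]
    ext1 i j
    exact h (.inl (i, j))
  · rw [← map_mul, ← map_one τ.mapMatrix]
    ext1 i j
    exact h (.inr (i, j))
  · refine Units.ext (Eq.trans ?_ hA)
    ext i j g
    exact TopCat.Presheaf.germ_res_apply Y.presheaf (homOfLE hVU) x hV ((A i j).coeff g)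

/-- As `Ô_{Y, η₀} = K(Y)`, an invertible matrix over `Ô_{Y, η₀}[G]` and its inverse have entries
defined on a common nonempty open set, so they come from `Ô_{Y, y}[G]` for all `y` in that set. -/
theorem exists_glMap_fromPoint_eq {Y : Scheme.{0}} [IrreducibleSpace Y] (hreg : IsRegularScheme Y)
    {G : Type*} [Group G] [Finite G] {n : ℕ}
    (P : GL (Fin n) (MonoidAlgebra (CompletedStalk Y (genericPoint Y)) G)) :
    ∃ W : Y.Opens, genericPoint Y ∈ W ∧ ∀ y ∈ W,
      ∃ Q : GL (Fin n) (MonoidAlgebra (CompletedStalk Y y) G),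
        glMap (MonoidAlgebra.mapRingHom G (fromPoint Y y)) n Q =
          glMap (MonoidAlgebra.mapRingHom G (fromGeneric Y y)) n P := by
  let e := RingEquiv.ofBijective _ (bijective_algebraMap_completedStalk_genericPoint hreg)
  obtain ⟨W, hW, Q, hQ⟩ := exists_GL_germ_eq
    (glMap (MonoidAlgebra.mapRingHom G e.symm.toRingHom) n P)
  have hP : P = glMap (MonoidAlgebra.mapRingHom G e.toRingHom) n
      (glMap (MonoidAlgebra.mapRingHom G e.symm.toRingHom) n P) := by
    ext i j g
    exact (e.apply_symm_apply _).symm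
  refine ⟨W, hW, fun y hy => ⟨glMap (MonoidAlgebra.mapRingHom G
    ((algebraMap (Y.presheaf.stalk y) (CompletedStalk Y y)).comp
      (Y.presheaf.germ W y hy).hom)) n Q, ?_⟩⟩
  rw [hP, ← hQ]
  ext i j g
  refine (fromPoint_algebraMap Y y (Y.presheaf.germ W y hy ((Q.val i j).coeff g))).trans ?_
  exact congr(fromGeneric Y y (algebraMap _ _ $(TopCat.Presheaf.germ_stalkSpecializes_apply
    Y.presheaf hy (genericPoint_specializes y) ((Q.val i j).coeff g))))

/-! ### Local frames of a bundle -/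

section Frames

variable {Y : Scheme.{0}} {G : Type*} [Group G] {n : ℕ}

/-- The sections `b` freely generate `E|_U` over `O_U[G]`. -/
def IsFrame (E : Y.Modules) (ρ : G →* End E) (U : Y.Opens) (b : Fin n → Γ(E, U)) : Prop :=
  ∀ (V : Y.Opens) (h : V ≤ U),
    ∃ B : Module.Basis (Fin n) (MonoidAlgebra Γ(Y, V) G) (sectionsRep E ρ V).asModule,
      ∀ k, B k = E.presheaf.map (homOfLE h).op (b k)

variable {E : Y.Modules} {ρ : G →* End E} {U : Y.Opens} {b : Fin n → Γ(E, U)}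

theorem modGerm_res {V : Y.Opens} (h : V ≤ U) {x : Y} (hx : x ∈ V) (s : Γ(E, U)) :
    modGerm E hx (E.presheaf.map (homOfLE h).op s) = modGerm E (h hx) s :=
  TopCat.Presheaf.germ_res_apply E.presheaf (homOfLE h) x hx s

theorem sectionsRep_res {V : Y.Opens} (h : V ≤ U) (g : G) (s : Γ(E, U)) :
    sectionsRep E ρ V g (E.presheaf.map (homOfLE h).op s) =
      E.presheaf.map (homOfLE h).op (sectionsRep E ρ U g s) :=
  NatTrans.naturality_apply (ρ g).mapPresheaf (homOfLE h).op s

theorem IsFrame.exists_sections_basis (hb : IsFrame E ρ U b) {V : Y.Opens} (h : V ≤ U) :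
    ∃ C : Module.Basis (G × Fin n) Γ(Y, V) Γ(E, V),
      ∀ p, C p = E.presheaf.map (homOfLE h).op (sectionsRep E ρ U p.1 (b p.2)) := by
  obtain ⟨C, hC⟩ := (asModule_basis_iff (sectionsRep E ρ V) _).1 (hb V h)
  exact ⟨C, fun p => (hC p.1 p.2).trans (sectionsRep_res h _ _)⟩

/-- The germs of a frame are a basis of the stalk. A relation between germs is a relation between
sections over a small enough open set, and so is trivial there. -/
theorem IsFrame.exists_stalk_basis [Finite G] (hb : IsFrame E ρ U b) {x : Y} (hx : x ∈ U) :
    ∃ B : Module.Basis (Fin n) (MonoidAlgebra (Y.presheaf.stalk x) G) (stalkRep E ρ x).asModule,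
      ∀ k, B k = (stalkRep E ρ x).asModuleEquiv.symm (modGerm E hx (b k)) := by
  have := Fintype.ofFinite G
  let c : G × Fin n → Γ(E, U) := fun p => sectionsRep E ρ U p.1 (b p.2)
  have hli : LinearIndependent (Y.presheaf.stalk x) fun p => modGerm E hx (c p) := by
    rw [Fintype.linearIndependent_iff]
    intro a ha p
    -- Lift the coefficients to sections, then shrink the open set until the relation holds on it.
    obtain ⟨V, hVU, hV, a', ha'⟩ := exists_germ_family_eq hx a
    have h0 : modGerm E hV (∑ p, a' p • E.presheaf.map (homOfLE hVU).op (c p)) =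
        modGerm E hV 0 := by
      rw [map_sum, map_zero, ← ha]
      refine Finset.sum_congr rfl fun p _ => ?_
      rw [modGerm_smul, ha', modGerm_res]
    obtain ⟨W, hW, iW, iW', hres⟩ := E.presheaf.germ_eq x hV hV _ _ h0
    obtain ⟨C, hC⟩ := hb.exists_sections_basis (iW.le.trans hVU)
    have h1 : ∑ p, Y.presheaf.map iW.op (a' p) • C p = 0 := by
      rw [map_zero, map_sum] at hres
      rw [← hres]
      refine Finset.sum_congr rfl fun p _ => ?_
      rw [Scheme.Modules.map_smul, hC, ← ConcreteCategory.comp_apply, ← Functor.map_comp]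
      rfl
    have h2 := Fintype.linearIndependent_iff.1 C.linearIndependent _ h1 p
    rw [← ha', ← TopCat.Presheaf.germ_res_apply Y.presheaf iW x hW, h2, map_zero]
  have hsp : ⊤ ≤ Submodule.span (Y.presheaf.stalk x) (Set.range fun p => modGerm E hx (c p)) := by
    intro m _
    obtain ⟨W, hW, -, s, -, rfl⟩ := exists_germs E x 0 m
    obtain ⟨C, hC⟩ := hb.exists_sections_basis (inf_le_left : U ⊓ W ≤ U)
    have hV : x ∈ U ⊓ W := ⟨hx, hW⟩
    rw [← modGerm_res (inf_le_right : U ⊓ W ≤ W) hV, ← C.sum_repr (E.presheaf.map _ s), map_sum]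
    refine Submodule.sum_mem _ fun p _ => ?_
    rw [modGerm_smul, hC, modGerm_res]
    exact Submodule.smul_mem _ _ (Submodule.subset_span ⟨p, rfl⟩)
  refine (asModule_basis_iff (stalkRep E ρ x) _).2 ⟨.mk hli hsp, fun g k => ?_⟩
  rw [Module.Basis.mk_apply]
  exact (modStalkMap_germ (ρ g) hx (b k)).symm

theorem IsFrame.exists_baseChange_basis [Finite G] (hb : IsFrame E ρ U b) {x : Y} (hx : x ∈ U)
    (T : Type*) [CommRing T] [Algebra (Y.presheaf.stalk x) T] :
    ∃ B : Module.Basis (Fin n) (MonoidAlgebra T G) (baseChangeRep T (stalkRep E ρ x)).asModule,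
      ∀ k, B k = (1 : T) ⊗ₜ[Y.presheaf.stalk x] modGerm E hx (b k) := by
  obtain ⟨B, hB⟩ := hb.exists_stalk_basis hx
  obtain ⟨B', hB'⟩ := baseChange_asModule_basis _ T B
  exact ⟨B', fun k => by rw [hB', hB]; rfl⟩

theorem IsBundle.exists_isFrame (hE : IsBundle E ρ n) (x : Y) :
    ∃ U : Y.Opens, x ∈ U ∧ ∃ b : Fin n → Γ(E, U), IsFrame E ρ U b := by
  obtain ⟨U, hx, -, b, hb⟩ := hE x
  exact ⟨U, hx, b, hb⟩

theorem IsBundle.nonempty_localBases [Finite G] (hE : IsBundle E ρ n) :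
    Nonempty (LocalBases E ρ n) := by
  refine ⟨fun x => Classical.choice ?_⟩
  obtain ⟨U, hx, b, hb⟩ := hE.exists_isFrame x
  exact ⟨(hb.exists_baseChange_basis hx (CompletedStalk Y x)).choose⟩

variable [IrreducibleSpace Y]

theorem modToGeneric_stalkRep (y : Y) (g : G) (m : ModStalk E y) :
    modToGeneric E y (stalkRep E ρ y g m) =
      stalkRep E ρ (genericPoint Y) g (modToGeneric E y m) := by
  obtain ⟨V, hy, -, m, -, rfl⟩ := exists_germs E y 0 m
  have hη := (genericPoint_specializes y).mem_open V.isOpen hy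
  have key : ∀ s : Γ(E, V), modToGeneric E y (modGerm E hy s) = modGerm E hη s := fun s =>
    TopCat.Presheaf.germ_stalkSpecializes_apply E.presheaf hy (genericPoint_specializes y) s
  rw [key]
  exact (congrArg _ (modStalkMap_germ (ρ g) hy m)).trans
    ((key _).trans (modStalkMap_germ (ρ g) hη m).symm)

theorem modFromGeneric_smul (y : Y) (r : MonoidAlgebra (CompletedStalk Y (genericPoint Y)) G)
    (m : CompletedModStalk E ρ (genericPoint Y)) :
    modFromGeneric E ρ y (r • m) =
      MonoidAlgebra.mapRingHom G (fromGeneric Y y) r • modFromGeneric E ρ y m := by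
  refine semilinear_of_tmul (stalkRep E ρ (genericPoint Y)) _ _ _ (fun a s g v => ?_) r m
  change fromGeneric Y y (a * s) ⊗ₜ _ = fromGeneric Y y a • (fromGeneric Y y s ⊗ₜ _)
  rw [TensorProduct.smul_tmul', smul_eq_mul, map_mul]
  rfl

theorem modFromPoint_smul (y : Y) (r : MonoidAlgebra (CompletedStalk Y y) G)
    (m : CompletedModStalk E ρ y) :
    modFromPoint E ρ y (r • m) =
      MonoidAlgebra.mapRingHom G (fromPoint Y y) r • modFromPoint E ρ y m := by
  refine semilinear_of_tmul (stalkRep E ρ y) _ _ _ (fun a s g v => ?_) r m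
  change fromPoint Y y (a * s) ⊗ₜ modToGeneric E y (stalkRep E ρ y g v) =
    fromPoint Y y a • (fromPoint Y y s ⊗ₜ stalkRep E ρ (genericPoint Y) g (modToGeneric E y v))
  rw [TensorProduct.smul_tmul', smul_eq_mul, map_mul, modToGeneric_stalkRep]

/-- For a frame `b` on `U` and `y ∈ U`, the bases `1 ⊗ b` of `Ê_y` and of `Ê_{η₀}` both map to the
basis `1 ⊗ b` of `Ê_{η₀ y}`. The basis `B₀` of `Ê_{η₀}` is an argument, so that it can be fixed
before `y` varies over `U`. -/
theorem IsFrame.exists_bases [Finite G] (hb : IsFrame E ρ U b) {y : Y} (hy : y ∈ U) :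
    ∃ (B : Module.Basis (Fin n) (MonoidAlgebra (CompletedStalk Y y) G) (CompletedModStalk E ρ y))
      (C : Module.Basis (Fin n) (MonoidAlgebra (Multicompletion Y y) G) (GenericModStalk E ρ y)),
      modFromPoint E ρ y ∘ B = C ∧
      ∀ B₀ : Module.Basis (Fin n) (MonoidAlgebra (CompletedStalk Y (genericPoint Y)) G)
          (CompletedModStalk E ρ (genericPoint Y)),
        (∀ k, B₀ k = (1 : CompletedStalk Y (genericPoint Y)) ⊗ₜ[Y.presheaf.stalk (genericPoint Y)]
          modGerm E ((genericPoint_specializes y).mem_open U.isOpen hy) (b k)) →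
        modFromGeneric E ρ y ∘ B₀ = C := by
  obtain ⟨B, hB⟩ := hb.exists_baseChange_basis hy (CompletedStalk Y y)
  obtain ⟨C, hC⟩ := hb.exists_baseChange_basis
    ((genericPoint_specializes y).mem_open U.isOpen hy) (Multicompletion Y y)
  refine ⟨B, C, ?_, fun B₀ hB₀ => ?_⟩
  · ext k
    rw [Function.comp_apply, hB, hC]
    change fromPoint Y y 1 ⊗ₜ modToGeneric E y (modGerm E hy (b k)) = _
    rw [map_one]
    congr 1
    exact TopCat.Presheaf.germ_stalkSpecializes_apply E.presheaf hy (genericPoint_specializes y) _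
  · ext k
    rw [Function.comp_apply, hB₀, hC]
    change fromGeneric Y y 1 ⊗ₜ _ = _
    rw [map_one]
    rfl

end Frames

/-! ### Transition matrices -/

section Transition

open scoped Matrix.Module

variable {Y : Scheme.{0}} [IrreducibleSpace Y] {G : Type*} [Group G] {n : ℕ}
  {E : Y.Modules} {ρ : G →* End E}

theorem isTransition_iff {e : LocalBases E ρ n}
    {lam : ∀ y : CodimOne Y, GL (Fin n) (MonoidAlgebra (Multicompletion Y y.1) G)} :
    IsTransition e lam ↔ ∀ y : CodimOne Y, modFromGeneric E ρ y.1 ∘ e (genericPoint Y) =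
      (lam y).val • (modFromPoint E ρ y.1 ∘ e y.1) :=
  forall_congr' fun _ => funext_iff.symm

variable [Finite G]

/-- The images in `Ê_{η₀ y}` of bases of `Ê_{η₀}` and of `Ê_y` differ from one and the same basis of
`Ê_{η₀ y}` by invertible matrices. -/
theorem IsBundle.exists_generic_basis (hE : IsBundle E ρ n) (y : Y) :
    ∃ C : Module.Basis (Fin n) (MonoidAlgebra (Multicompletion Y y) G) (GenericModStalk E ρ y),
      (∀ e : Module.Basis (Fin n) (MonoidAlgebra (CompletedStalk Y (genericPoint Y)) G)
          (CompletedModStalk E ρ (genericPoint Y)),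
        ∃ P : GL (Fin n) (MonoidAlgebra (Multicompletion Y y) G),
          modFromGeneric E ρ y ∘ e = P.val • (C : Fin n → GenericModStalk E ρ y)) ∧
      (∀ e : Module.Basis (Fin n) (MonoidAlgebra (CompletedStalk Y y) G)
          (CompletedModStalk E ρ y),
        ∃ P : GL (Fin n) (MonoidAlgebra (Multicompletion Y y) G),
          modFromPoint E ρ y ∘ e = P.val • (C : Fin n → GenericModStalk E ρ y)) := by
  obtain ⟨U, hy, b, hb⟩ := hE.exists_isFrame y
  obtain ⟨B₀, hB₀⟩ := hb.exists_baseChange_basis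
    ((genericPoint_specializes y).mem_open U.isOpen hy) (CompletedStalk Y (genericPoint Y))
  obtain ⟨B, C, hBC, hC⟩ := hb.exists_bases hy
  refine ⟨C, fun e => ?_, fun e => ?_⟩
  · obtain ⟨A, hA⟩ := exists_basis_eq_GL_smul
      (R := MonoidAlgebra (CompletedStalk Y (genericPoint Y)) G)
      (M := CompletedModStalk E ρ (genericPoint Y)) B₀ e
    refine ⟨glMap (MonoidAlgebra.mapRingHom G (fromGeneric Y y)) n A, ?_⟩
    rw [hA, comp_GL_smul_of_semilinear _ (modFromGeneric_smul y), hC B₀ hB₀]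
  · obtain ⟨A, hA⟩ := exists_basis_eq_GL_smul (R := MonoidAlgebra (CompletedStalk Y y) G)
      (M := CompletedModStalk E ρ y) B e
    refine ⟨glMap (MonoidAlgebra.mapRingHom G (fromPoint Y y)) n A, ?_⟩
    rw [hA, comp_GL_smul_of_semilinear _ (modFromPoint_smul y), hBC]

theorem IsBundle.existsUnique_GL_smul (hE : IsBundle E ρ n) (e : LocalBases E ρ n) (y : Y) :
    ∃! L : GL (Fin n) (MonoidAlgebra (Multicompletion Y y) G),
      modFromGeneric E ρ y ∘ e (genericPoint Y) = L.val • (modFromPoint E ρ y ∘ e y) := by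
  obtain ⟨C, h0, h1⟩ := hE.exists_generic_basis y
  obtain ⟨P, hP⟩ := h0 (e (genericPoint Y))
  obtain ⟨Q, hQ⟩ := h1 (e y)
  have key : ∀ L : GL (Fin n) (MonoidAlgebra (Multicompletion Y y) G),
      modFromGeneric E ρ y ∘ e (genericPoint Y) = L.val • (modFromPoint E ρ y ∘ e y) ↔
        P = L * Q := fun L => by
    rw [hP, hQ, ← mul_smul]
    exact ((smul_basis_injective (R := MonoidAlgebra (Multicompletion Y y) G)
      (M := GenericModStalk E ρ y) C).eq_iff (a := P.val) (b := L.val * Q.val)).trans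
      (Units.ext_iff (u := P) (v := L * Q)).symm
  refine ⟨P * Q⁻¹, (key _).2 (by group), fun L hL => ?_⟩
  rw [(key L).1 hL]
  group

theorem IsBundle.existsUnique_isTransition (hE : IsBundle E ρ n) (e : LocalBases E ρ n) :
    ∃! lam : ∀ y : CodimOne Y, GL (Fin n) (MonoidAlgebra (Multicompletion Y y.1) G),
      IsTransition e lam := by
  choose lam h hu using fun y : CodimOne Y => hE.existsUnique_GL_smul e y.1
  exact ⟨lam, isTransition_iff.2 h, fun lam' h' => funext fun y =>
    hu y _ (isTransition_iff.1 h' y)⟩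

/-- On a frame around `η₀`, the transition matrix becomes the product of a matrix over `Ô_{Y, η₀}[G]`
and one over `Ô_{Y, y}[G]`. The first does not depend on `y` and is defined at all `y` in some
nonempty open set. -/
theorem IsBundle.Det_mem_K1PointFlat (hE : IsBundle E ρ n) {e : LocalBases E ρ n}
    {lam : ∀ y : CodimOne Y, GL (Fin n) (MonoidAlgebra (Multicompletion Y y.1) G)}
    (h : IsTransition e lam) (hreg : IsRegularScheme Y) :
    ∃ W : Y.Opens, genericPoint Y ∈ W ∧
      ∀ y : CodimOne Y, y.1 ∈ W → Det (lam y) ∈ K1PointFlat Y G y.1 := by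
  obtain ⟨U, hU, b, hb⟩ := hE.exists_isFrame (genericPoint Y)
  obtain ⟨B₀, hB₀⟩ := hb.exists_baseChange_basis hU (CompletedStalk Y (genericPoint Y))
  obtain ⟨A₀, hA₀⟩ := exists_basis_eq_GL_smul
      (R := MonoidAlgebra (CompletedStalk Y (genericPoint Y)) G)
      (M := CompletedModStalk E ρ (genericPoint Y)) B₀ (e (genericPoint Y))
  obtain ⟨W, hW, hQ⟩ := exists_glMap_fromPoint_eq hreg A₀
  refine ⟨U ⊓ W, ⟨hU, hW⟩, fun y hy => ?_⟩
  obtain ⟨B, C, hBC, hC⟩ := hb.exists_bases hy.1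
  obtain ⟨A, hA⟩ := exists_basis_eq_GL_smul
    (R := MonoidAlgebra (CompletedStalk Y y.1) G) (M := CompletedModStalk E ρ y.1) (e y.1) B
  obtain ⟨Q, hQ⟩ := hQ y.1 hy.2
  refine ⟨Det (Q * A), ?_⟩
  rw [K1_map_Det, map_mul]
  congr 1
  refine (hE.existsUnique_GL_smul e y.1).unique ?_ (isTransition_iff.1 h y)
  rw [hA₀, comp_GL_smul_of_semilinear _ (modFromGeneric_smul y.1), hC B₀ hB₀, ← hBC, hA,
    comp_GL_smul_of_semilinear _ (modFromPoint_smul y.1), hQ, ← mul_smul]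
  rfl

theorem IsBundle.prodDet_mem (hE : IsBundle E ρ n) {e : LocalBases E ρ n}
    {lam : ∀ y : CodimOne Y, GL (Fin n) (MonoidAlgebra (Multicompletion Y y.1) G)}
    (h : IsTransition e lam) (hreg : IsRegularScheme Y) [NoetherianSpace Y] :
    prodDet lam ∈ K1Adele01' Y G := by
  obtain ⟨W, hW, hflat⟩ := hE.Det_mem_K1PointFlat h hreg
  exact (finite_codimOne_notMem W hW).subset fun y hy hyW => hy (hflat y hyW)

/-- A change of bases multiplies `λ_{η₀ η₁}` on the left by the change of basis at `η₀` and on the right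
by the change of basis at `η₁`. -/
theorem IsBundle.inv_prodDet_mul_prodDet_mem (hE : IsBundle E ρ n) {e e' : LocalBases E ρ n}
    {lam lam' : ∀ y : CodimOne Y, GL (Fin n) (MonoidAlgebra (Multicompletion Y y.1) G)}
    (h : IsTransition e lam) (h' : IsTransition e' lam') :
    (prodDet lam)⁻¹ * prodDet lam' ∈ K1Adele0Flat Y G ⊔ K1Adele1Flat Y G := by
  obtain ⟨A₀, hA₀⟩ := exists_basis_eq_GL_smul
      (R := MonoidAlgebra (CompletedStalk Y (genericPoint Y)) G)
      (M := CompletedModStalk E ρ (genericPoint Y)) (e (genericPoint Y)) (e' (genericPoint Y))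
  choose A hA using fun y : CodimOne Y => exists_basis_eq_GL_smul
    (R := MonoidAlgebra (CompletedStalk Y y.1) G) (M := CompletedModStalk E ρ y.1) (e' y.1) (e y.1)
  have key : ∀ y : CodimOne Y, lam' y =
      glMap (MonoidAlgebra.mapRingHom G (fromGeneric Y y.1)) n A₀ * lam y *
        glMap (MonoidAlgebra.mapRingHom G (fromPoint Y y.1)) n (A y) := fun y => by
    refine (hE.existsUnique_GL_smul e' y.1).unique (isTransition_iff.1 h' y) ?_
    rw [hA₀, comp_GL_smul_of_semilinear _ (modFromGeneric_smul y.1), isTransition_iff.1 h y, hA y,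
      comp_GL_smul_of_semilinear _ (modFromPoint_smul y.1), ← mul_smul, ← mul_smul]
    rfl
  have : (prodDet lam)⁻¹ * prodDet lam' =
      (fun y : CodimOne Y => K1.map (MonoidAlgebra.mapRingHom G (fromGeneric Y y.1)) (Det A₀)) *
        fun y : CodimOne Y => K1.map (MonoidAlgebra.mapRingHom G (fromPoint Y y.1)) (Det (A y)) := by
    funext y
    change (Det (lam y))⁻¹ * Det (lam' y) = K1.map _ (Det A₀) * K1.map _ (Det (A y))
    rw [key, Det_mul, Det_mul, K1_map_Det, K1_map_Det, mul_comm (Det (glMap _ n A₀)), mul_assoc,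
      inv_mul_cancel_left]
  rw [this]
  exact Subgroup.mul_mem_sup ⟨Det A₀, rfl⟩ fun y _ => ⟨Det (A y), rfl⟩

end Transition

end AdelicChow

end

theorem mainTheorem12 (Y : Scheme.{0}) [IrreducibleSpace Y] (hreg : IsRegularScheme Y)
    (hproj : IsProjectiveOverInt Y) (f : Y ⟶ Spec (CommRingCat.of ℤ)) (hflat : Flat f)
    (G : Type*) [Group G] [Finite G] (n : ℕ) (E : Y.Modules) (ρ : G →* End E)
    (hE : IsBundle E ρ n) :
    Nonempty (LocalBases E ρ n) ∧
    (∀ e : LocalBases E ρ n,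
      ∃! lam : ∀ y : CodimOne Y, GL (Fin n) (MonoidAlgebra (Multicompletion Y y.1) G),
        IsTransition e lam) ∧
    (∀ (e : LocalBases E ρ n)
      (lam : ∀ y : CodimOne Y, GL (Fin n) (MonoidAlgebra (Multicompletion Y y.1) G)),
      IsTransition e lam → prodDet lam ∈ K1Adele01' Y G) ∧
    (∃! c : CH1 Y G, ∀ (e : LocalBases E ρ n)
      (lam : ∀ y : CodimOne Y, GL (Fin n) (MonoidAlgebra (Multicompletion Y y.1) G)),
      IsTransition e lam →
        ∃ h : prodDet lam ∈ K1Adele01' Y G, (QuotientGroup.mk ⟨prodDet lam, h⟩ : CH1 Y G) = c) := by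
  have := isNoetherian_of_isProjectiveOverInt hproj
  obtain ⟨e₀⟩ := hE.nonempty_localBases
  obtain ⟨lam₀, h₀, -⟩ := hE.existsUnique_isTransition e₀
  refine ⟨⟨e₀⟩, hE.existsUnique_isTransition, fun e lam h => hE.prodDet_mem h hreg,
    QuotientGroup.mk ⟨prodDet lam₀, hE.prodDet_mem h₀ hreg⟩, fun e lam h => ?_, fun c hc => ?_⟩
  · exact ⟨hE.prodDet_mem h hreg, QuotientGroup.eq.2 (Subgroup.mem_subgroupOf.2
      (hE.inv_prodDet_mul_prodDet_mem h h₀))⟩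
  · obtain ⟨_, h⟩ := hc e₀ lam₀ h₀
    exact h.symm
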